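/- All graphs are finite, simple and undirected. A total-coloring of a graph $G$ assigns a color to every vertex and every edge of $G$ (not necessarily properly). Given a total-coloring, a path is total-rainbow if the colors of all its edges and inner vertices (that is, all its vertices other than its two ends) are pairwise distinct. For a connected graph $G$, the total-rainbow connection number $trc(G)$ is the minimum number of colors in a total-coloring of $G$ for which every two distinct vertices of $G$ are connected by a total-rainbow path. Theorem. If $G$ is a bridgeless graph (no edge is a cut edge) of order $n$ with diameter $2$, then $trc(G)\leq n-1$. -/

import Mathlib

namespace SimpleGraph

variable {V : Type*}

/-- A graph is *bridgeless* if none of its edges is a bridge. -/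
def Bridgeless (G : SimpleGraph V) : Prop :=
  ∀ e ∈ G.edgeSet, ¬ G.IsBridge e

/-- A (not necessarily proper) *total-coloring* of a graph with colors in `K`: every vertex and
every edge is assigned a color. -/
structure TotalColoring (G : SimpleGraph V) (K : Type*) where
  /-- the color of a vertex -/
  vertexColor : V → K
  /-- the color of an edge -/
  edgeColor : G.edgeSet → K

namespace Walk

variable {G : SimpleGraph V}

/-- The list of the edges of a walk, as elements of the edge set of the graph. -/
def edgeList {u v : V} (p : G.Walk u v) : List G.edgeSet :=
  p.darts.map fun d => ⟨d.edge, d.edge_mem⟩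

/-- The inner vertices of a walk: all of its vertices except the first and the last one. -/
def innerVertices {u v : V} (p : G.Walk u v) : List V :=
  p.support.tail.dropLast

/-- A walk is a *total-rainbow path* for a total-coloring if it is a path and the colors of its
edges and of its inner vertices are pairwise distinct. -/
def IsTotalRainbowPath {u v : V} (p : G.Walk u v) {K : Type*} (c : G.TotalColoring K) : Prop :=
  p.IsPath ∧ (p.edgeList.map c.edgeColor ++ p.innerVertices.map c.vertexColor).Nodup

end Walk

/-- A total-coloring makes the graph *total-rainbow connected* if every two distinct vertices are
connected by a total-rainbow path. -/
def TotalColoring.IsTRC {G : SimpleGraph V} {K : Type*} (c : G.TotalColoring K) : Prop :=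
  ∀ u v : V, u ≠ v → ∃ p : G.Walk u v, p.IsTotalRainbowPath c

/-- The *total-rainbow connection number*: the minimum number of colors in a total-coloring that
makes the graph total-rainbow connected (`⊤` if no number of colors suffices, which
does not happen for a finite connected graph). -/
noncomputable def trc (G : SimpleGraph V) : ℕ∞ :=
  ⨅ k ∈ {k : ℕ | ∃ c : G.TotalColoring (Fin k), c.IsTRC}, (k : ℕ∞)

end SimpleGraph

namespace SimpleGraph

variable {V : Type*} {G : SimpleGraph V}

/-! Nonadjacent vertices have a common neighbour, so it suffices to make suitable paths of length
two rainbow. If some `r` is universal, all of them can run through `r`; bridgelessness gives a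
triangle at `r`, two of whose spokes may share a color, which leaves `r` a color of its own
(`trc_le_of_universal`). Otherwise label the vertices by `ZMod n`: edge colors `i + j` are distinct
around each vertex, and merging two consecutive colors can only hurt pairs with consecutive labels.
Counting yields a harmless merge, and as degrees are at most `n - 2`, each vertex still misses a
color (`trc_le_of_no_universal`). -/

theorem TotalColoring.IsTRC.trc_le {K : Type*} [Fintype K] {c : G.TotalColoring K}
    (hc : c.IsTRC) : G.trc ≤ (Fintype.card K : ℕ∞) := by
  refine iInf₂_le (Fintype.card K) ?_
  let e := Fintype.equivFin K
  refine ⟨⟨e ∘ c.vertexColor, e ∘ c.edgeColor⟩, fun u v huv => ?_⟩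
  obtain ⟨p, hp, hnd⟩ := hc u v huv
  refine ⟨p, hp, ?_⟩
  have := hnd.map e.injective
  simpa [List.map_append, List.map_map] using this

/-- A coloring in which any two distinct nonadjacent vertices are joined by a total-rainbow path
of length two bounds the total-rainbow connection number. -/
theorem trc_le_of_forall_not_adj {K : Type*} [Fintype K] (f : V → V → K)
    (hf : ∀ u v, f u v = f v u) (g : V → K)
    (h : ∀ u v, u ≠ v → ¬ G.Adj u v →
      ∃ w, G.Adj u w ∧ G.Adj w v ∧ f u w ≠ f w v ∧ g w ≠ f u w ∧ g w ≠ f w v) :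
    G.trc ≤ (Fintype.card K : ℕ∞) := by
  let c : G.TotalColoring K := ⟨g, fun e => Sym2.lift ⟨f, hf⟩ e.1⟩
  refine TotalColoring.IsTRC.trc_le (c := c) fun u v huv => ?_
  by_cases hadj : G.Adj u v
  · refine ⟨.cons hadj .nil, ?_, ?_⟩
    · simp [huv]
    · simp [Walk.edgeList, Walk.innerVertices]
  · obtain ⟨w, huw, hwv, h₁, h₂, h₃⟩ := h u v huv hadj
    refine ⟨.cons huw (.cons hwv .nil), ?_, ?_⟩
    · simp [huv, huw.ne, hwv.ne]
    · simp [Walk.edgeList, Walk.innerVertices, c, h₁, h₂.symm, h₃.symm]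

theorem exists_common_adj_of_diam_eq_two (hdiam : G.diam = 2) {u v : V} (huv : u ≠ v)
    (hadj : ¬ G.Adj u v) : ∃ w, G.Adj u w ∧ G.Adj w v := by
  -- `diam` is 0 when `ediam` is infinite, so diameter 2 forces connectedness.
  have htop : G.ediam ≠ ⊤ := by
    intro h
    simp [diam, h] at hdiam
  have : Nonempty V := ⟨u⟩
  have hconn := connected_of_ediam_ne_top htop
  have hle : G.dist u v ≤ 2 := hdiam ▸ dist_le_diam htop
  obtain ⟨p, hp⟩ := hconn.exists_walk_length_eq_dist u v
  rw [← hp] at hle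
  match p, hle with
  | .nil, _ => exact absurd rfl huv
  | .cons h .nil, _ => exact absurd h hadj
  | .cons h (.cons h' .nil), _ => exact ⟨_, h, h'⟩
  | .cons _ (.cons _ (.cons _ _)), hle => simp at hle

/-- Otherwise deleting the only edge at `v` would isolate `v`. -/
theorem Bridgeless.exists_adj_ne (hG : G.Bridgeless) {r v : V} (h : G.Adj v r) :
    ∃ w, G.Adj v w ∧ w ≠ r := by
  by_contra! hcon
  refine hG s(v, r) h ?_
  rw [isBridge_iff]
  intro hreach
  obtain ⟨p⟩ := hreach
  cases p with
  | nil => exact h.ne rfl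
  | cons h' _ =>
    rw [deleteEdges_adj] at h'
    obtain rfl := hcon _ h'.1
    exact h'.2 rfl

/-- Bound in the presence of a vertex `r` adjacent to all others: the edge from `r` to `v` gets
color `v`, except that the edges from `r` to two adjacent vertices share a color. -/
theorem trc_le_of_universal [Fintype V] {r p q : V} (hr : ∀ v, v ≠ r → G.Adj r v)
    (hpq : G.Adj p q) (hp : p ≠ r) (hq : q ≠ r) : G.trc ≤ ((Fintype.card V - 1 : ℕ) : ℕ∞) := by
  classical
  let π : V → {x : V // x ≠ p} := fun v => if h : v = p then ⟨q, hpq.ne'⟩ else ⟨v, h⟩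
  have hπ : ∀ v, v ≠ r → π v ≠ ⟨r, hp.symm⟩ := by
    intro v hv
    by_cases h : v = p <;> simp [π, h, hv, hq]
  have hcard : Fintype.card {x : V // x ≠ p} = Fintype.card V - 1 := by simp
  rw [← hcard]
  refine trc_le_of_forall_not_adj
    (fun u v => if u = r then π v else if v = r then π u else ⟨r, hp.symm⟩) ?_
    (fun _ => ⟨r, hp.symm⟩) ?_
  · intro u v
    by_cases hu : u = r <;> by_cases hv : v = r <;> simp [hu, hv]
  · intro u v huv hadj
    have hu : u ≠ r := by
      rintro rfl
      exact hadj (hr v huv.symm)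
    have hv : v ≠ r := by
      rintro rfl
      exact hadj (hr u huv).symm
    refine ⟨r, (hr u hu).symm, hr v hv, ?_, ?_, ?_⟩
    · simp only [hu, if_false, if_true]
      intro h
      -- Only the spokes to `p` and `q` share a color, and `p`, `q` are adjacent.
      by_cases h₁ : u = p <;> by_cases h₂ : v = p
      · exact huv (h₁.trans h₂.symm)
      · simp only [π, h₁, h₂, dif_pos, dif_neg, not_false_eq_true, Subtype.mk.injEq] at h
        exact hadj (h₁ ▸ h ▸ hpq)
      · simp only [π, h₁, h₂, dif_pos, dif_neg, not_false_eq_true, Subtype.mk.injEq] at h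
        exact hadj (h₂ ▸ h ▸ hpq.symm)
      · simp only [π, h₁, h₂, dif_neg, not_false_eq_true, Subtype.mk.injEq] at h
        exact huv h
    · simpa [hu] using (hπ u hu).symm
    · simpa using (hπ v hv).symm

theorem exists_equiv_zmod [Fintype V] {n : ℕ} [NeZero n] (hn : Fintype.card V = n) (h2 : 2 ≤ n)
    {p q : V} (hpq : p ≠ q) : ∃ e : V ≃ ZMod n, e p = 1 ∧ e q = 0 := by
  classical
  have : Fact (1 < n) := ⟨h2⟩
  let e₀ : V ≃ ZMod n := Fintype.equivOfCardEq (by simp [hn, ZMod.card])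
  let e₁ := e₀.trans (Equiv.swap (e₀ p) 1)
  have h₁ : e₁ p = 1 := by simp [e₁]
  have h₁q : (1 : ZMod n) ≠ e₁ q := fun h => hpq (e₁.injective (h₁.trans h))
  refine ⟨e₁.trans (Equiv.swap (e₁ q) 0), ?_, by simp⟩
  simp only [Equiv.trans_apply, h₁]
  exact Equiv.swap_apply_of_ne_of_ne h₁q one_ne_zero

/-- Bound in the absence of universal vertices: identifying the vertices with `ZMod n`, the edge
`ij` gets color `i + j`, where two suitable consecutive colors `a - 1` and `a` are merged. Every
vertex gets a color missing at its edges. -/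
theorem trc_le_of_no_universal [Fintype V] {n : ℕ} (hn : Fintype.card V = n) (h3 : 3 ≤ n)
    (hcommon : ∀ u v, u ≠ v → ¬ G.Adj u v → ∃ w, G.Adj u w ∧ G.Adj w v)
    (hnon : ∀ r, ∃ v, v ≠ r ∧ ¬ G.Adj r v) {p q : V} (hpq : G.Adj p q) :
    G.trc ≤ ((n - 1 : ℕ) : ℕ∞) := by
  classical
  have : NeZero n := ⟨by omega⟩
  have : Fact (1 < n) := ⟨by omega⟩
  have htwo : (2 : ZMod n) ≠ 0 := by
    intro h
    have h' : ((2 : ℕ) : ZMod n) = 0 := by exact_mod_cast h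
    rw [ZMod.natCast_eq_zero_iff] at h'
    have := Nat.le_of_dvd (by norm_num) h'
    omega
  obtain ⟨e, hep, heq⟩ := exists_equiv_zmod hn (by omega) hpq.ne
  have hpred : ∀ x : ZMod n, x ≠ x - 1 := fun x h =>
    one_ne_zero (α := ZMod n) (by linear_combination h)
  have hchoice : ∀ x : ZMod n, ∃ w, ¬ G.Adj (e.symm x) (e.symm (x - 1)) →
      G.Adj (e.symm x) w ∧ G.Adj w (e.symm (x - 1)) := by
    intro x
    by_cases h : G.Adj (e.symm x) (e.symm (x - 1))
    · exact ⟨p, fun h' => absurd h h'⟩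
    · obtain ⟨w, hw⟩ := hcommon _ _ (e.symm.injective.ne (hpred x)) h
      exact ⟨w, fun _ => hw⟩
  choose m hm using hchoice
  -- The labels 1 and 0 belong to the adjacent `p` and `q`, so `x = 1` imposes nothing: at most `n -
  -- 1` of the `n` values are forbidden.
  obtain ⟨a, ha⟩ : ∃ a, a ∉ (Finset.univ.erase (1 : ZMod n)).image fun x => x + e (m x) := by
    by_contra! hall
    have h₁ := Finset.card_le_card (fun a _ => hall a : Finset.univ ⊆ _)
    have h₂ := h₁.trans Finset.card_image_le
    rw [Finset.card_erase_of_mem (Finset.mem_univ _), Finset.card_univ, ZMod.card] at h₂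
    omega
  let π : ZMod n → {x : ZMod n // x ≠ a} :=
    fun x => if h : x = a then ⟨a - 1, by simp⟩ else ⟨x, h⟩
  have hπ : ∀ x y, x ≠ y → π x = π y → (x = a ∧ y = x - 1) ∨ (y = a ∧ x = y - 1) := by
    intro x y hxy h
    by_cases hx : x = a <;> by_cases hy : y = a
    · exact absurd (hx.trans hy.symm) hxy
    · simp only [π, hx, hy, dif_pos, dif_neg, not_false_eq_true, Subtype.mk.injEq] at h
      exact .inl ⟨hx, by rw [hx, h]⟩
    · simp only [π, hx, hy, dif_pos, dif_neg, not_false_eq_true, Subtype.mk.injEq] at h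
      exact .inr ⟨hy, by rw [hy, h]⟩
    · simp only [π, hx, hy, dif_neg, not_false_eq_true, Subtype.mk.injEq] at h
      exact absurd h hxy
  have hcard : Fintype.card {x : ZMod n // x ≠ a} = n - 1 := by simp [ZMod.card]
  have hmissing : ∀ w, ∃ k, ∀ u, G.Adj u w → k ≠ π (e u + e w) := by
    intro w
    obtain ⟨v, hv, hwv⟩ := hnon w
    -- At most `n - 2` neighbours against `n - 1` colors.
    have hlt : (((Finset.univ.erase w).erase v).image fun u => π (e u + e w)).card <
        (Finset.univ : Finset {x : ZMod n // x ≠ a}).card := by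
      refine Finset.card_image_le.trans_lt ?_
      rw [Finset.card_univ, hcard, Finset.card_erase_of_mem (by simp [hv]),
        Finset.card_erase_of_mem (Finset.mem_univ _), Finset.card_univ, hn]
      omega
    obtain ⟨k, -, hk⟩ := Finset.exists_mem_notMem_of_card_lt_card hlt
    refine ⟨k, fun u huw h => hk ?_⟩
    refine Finset.mem_image.2 ⟨u, ?_, h.symm⟩
    simp only [Finset.mem_erase, Finset.mem_univ, and_true]
    exact ⟨fun h' => hwv (h' ▸ huw.symm), huw.ne⟩
  choose g hg using hmissing
  /- Two vertices with consecutive labels are handled by the choice of `a`. -/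
  have hcons : ∀ u v, e v = e u - 1 → ¬ G.Adj u v →
      ∃ w, G.Adj u w ∧ G.Adj w v ∧ π (e u + e w) ≠ π (e v + e w) := by
    intro u v huv hadj
    have hu : u = e.symm (e u) := by simp
    have hv : v = e.symm (e u - 1) := by rw [← huv]; simp
    obtain ⟨h₁, h₂⟩ := hm (e u) (by rwa [← hv, ← hu])
    rw [← hu] at h₁
    rw [← hv] at h₂
    refine ⟨m (e u), h₁, h₂, fun h => ?_⟩
    have hne : e u + e (m (e u)) ≠ e v + e (m (e u)) := by
      rw [huv]
      intro h
      exact hpred _ (add_right_cancel h)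
    rcases hπ _ _ hne h with h' | h'
    · refine ha (Finset.mem_image.2 ⟨e u, ?_, h'.1⟩)
      refine Finset.mem_erase.2 ⟨fun h1 => hadj ?_, Finset.mem_univ _⟩
      have hup : u = p := e.injective (h1.trans hep.symm)
      have hvq : v = q := e.injective (by rw [huv, h1, heq, sub_self])
      exact hup ▸ hvq ▸ hpq
    -- The merged colors in the opposite order would give `e u = e v - 1` besides `e v = e u - 1`,
    -- hence `2 = 0`.
    · exact htwo (by linear_combination h'.2 + huv)
  rw [← hcard]
  refine trc_le_of_forall_not_adj (fun u v => π (e u + e v)) (fun u v => by rw [add_comm]) g ?_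
  have key : ∀ u v, u ≠ v → ¬ G.Adj u v →
      ∃ w, G.Adj u w ∧ G.Adj w v ∧ π (e u + e w) ≠ π (e v + e w) := by
    intro u v huv hadj
    by_cases h₁ : e v = e u - 1
    · exact hcons u v h₁ hadj
    by_cases h₂ : e u = e v - 1
    · obtain ⟨w, hvw, hwu, h⟩ := hcons v u h₂ fun h => hadj h.symm
      exact ⟨w, hwu.symm, hvw.symm, h.symm⟩
    obtain ⟨w, huw, hwv⟩ := hcommon u v huv hadj
    refine ⟨w, huw, hwv, fun h => ?_⟩
    rcases hπ _ _ (fun h => huv (e.injective (add_right_cancel h))) h with h' | h'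
    · exact h₁ (by linear_combination h'.2)
    · exact h₂ (by linear_combination h'.2)
  intro u v huv hadj
  obtain ⟨w, huw, hwv, h⟩ := key u v huv hadj
  refine ⟨w, huw, hwv, ?_, hg w u huw, ?_⟩
  · rwa [add_comm (e w)]
  · rw [add_comm]
    exact hg w v hwv.symm

end SimpleGraph

open SimpleGraph in
theorem trc_le_card_sub_one_of_diam_eq_two {V : Type*} [Fintype V] {G : SimpleGraph V}
    (hbridgeless : G.Bridgeless) (hdiam : G.diam = 2) :
    G.trc ≤ ((Fintype.card V - 1 : ℕ) : ℕ∞) := by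
  classical
  obtain ⟨x, y, hxy, hadj⟩ : ∃ x y, x ≠ y ∧ ¬ G.Adj x y := by
    by_contra! h
    have hG : G = ⊤ := by
      ext u v
      exact ⟨fun h' => h'.ne, fun h' => h u v h'⟩
    have : Nontrivial V := nontrivial_of_diam_ne_zero (G := G) (by omega)
    have := diam_eq_one.2 hG
    omega
  obtain ⟨w, hxw, hwy⟩ := exists_common_adj_of_diam_eq_two hdiam hxy hadj
  by_cases huniv : ∃ r, ∀ v, v ≠ r → G.Adj r v
  · obtain ⟨r, hr⟩ := huniv
    have hxr : x ≠ r := by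
      rintro rfl
      exact hadj (hr y hxy.symm)
    obtain ⟨q, hq, hqr⟩ := hbridgeless.exists_adj_ne (hr x hxr).symm
    exact trc_le_of_universal hr hq hxr hqr
  · push Not at huniv
    have h3 : 3 ≤ Fintype.card V :=
      Finset.two_lt_card_iff.2 ⟨x, w, y, by simp, by simp, by simp, hxw.ne, hxy, hwy.ne⟩
    exact trc_le_of_no_universal rfl h3
      (fun u v => exists_common_adj_of_diam_eq_two hdiam) huniv hxw

theorem theorem4p1 {V : Type*} [Fintype V] (G : SimpleGraph V) (n : ℕ)
    (hn : Fintype.card V = n) (hbridgeless : G.Bridgeless) (hdiam : G.diam = 2) :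
    G.trc ≤ ((n - 1 : ℕ) : ℕ∞) := by
  subst hn
  exact trc_le_card_sub_one_of_diam_eq_two hbridgeless hdiam
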